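/- An effect algebra is a set $L$ with elements $0,1$ and a partial binary operation $\oplus$ that is commutative and associative (where defined), such that every $a$ has a unique $a'$ with $a\oplus a'=1$, and $1\oplus a$ is defined only for $a=0$; $a\le b$ means $a\oplus c=b$ for some $c$. A system $(a_i)_{i\in I}$ in $L$ is orthogonal if $\bigoplus_{i\in J}a_i$ exists for every finite $J\subseteq I$, and then $\bigoplus_{i\in I}a_i:=\bigvee_J\bigoplus_{i\in J}a_i$ if this join exists; $L$ is $\sigma$-orthocomplete if the sum exists for every countable orthogonal system. A $\sigma$-additive state is a map $m:L\to[0,1]$ with $m(1)=1$ that is additive on all existing countable (including finite) $\oplus$-sums. A nonempty set $S$ of states is order determining if $a\le b\iff m(a)\le m(b)$ for all $m\in S$. An element $a$ is sharp if $0$ is the only common lower bound of $a$ and $a'$. Let $L$ be a $\sigma$-orthocomplete effect algebra, $S$ an order determining set of $\sigma$-additive states on $L$, and $(X,\mathcal A)$, $(Y,\mathcal B)$ measurable spaces. An observable $\xi:(X,\mathcal A)\to L$ is a map $\xi:\mathcal A\to L$ with $\xi(X)=1$ such that for pairwise disjoint $E_1,E_2,\ldots\in\mathcal A$ the system $(\xi(E_i))_i$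 is orthogonal with $\bigoplus_i\xi(E_i)=\xi(\bigcup_iE_i)$. Its range is $\mathcal R(\xi)=\{\xi(A):A\in\mathcal A\}$; it is sharp if all elements of its range are sharp, and real if its value space is (up to isomorphism) a Borel subset of $\mathbb R$ with its Borel $\sigma$-algebra. For $m\in S$, $m\circ\xi$ is a probability measure on $\mathcal A$. A map $\nu:X\times\mathcal B\to\mathbb R$ is a weak Markov kernel with respect to $\{m\circ\xi:m\in S\}$ if $\nu(\cdot,B)$ is $\mathcal A$-measurable for every $B\in\mathcal B$ and, for every $m\in S$, the following hold $m\circ\xi$-almost everywhere: $0\le\nu(\cdot,B)\le1$ for each $B\in\mathcal B$; $\nu(\cdot,Y)=1$; $\nu(\cdot,\emptyset)=0$; and $\nu(\cdot,\bigcup_nB_n)=\sum_n\nu(\cdot,B_n)$ for each sequence of pairwise disjoint $B_n\in\mathcal B$ (the exceptional set may depend on $B$, resp. on $(B_n)$). A Markov kernel is a map $\nu:X\times\mathcal B\to[0,1]$ such that every $\nu(\cdot,B)$ is $\mathcal A$-measurable and every $\nu(x,\cdot)$ is a probability measure; in particular it is a weak Markov kernel. An observable $\eta:(Y,\mathcal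 B)\to L$ is a smearing of $\xi$ by $\nu$ if $m(\eta(G))=\int_X\nu(x,G)\,m(\xi(dx))$ for all $G\in\mathcal B$ and $m\in S$. **Theorem.** Let $\xi:(X,\mathcal A)\to L$ and $\eta:(Y,\mathcal B)\to L$ be observables. 1. If $\eta$ is a smearing of $\xi$ by a weak Markov kernel $\nu$ (in particular, by a Markov kernel) such that for every $E\in\mathcal B$ and every $m\in S$ one has $\nu(x,E)\in\{0,1\}$ for $m\circ\xi$-almost every $x$, then $\mathcal R(\eta)\subseteq\mathcal R(\xi)$. 2. Conversely, if $\xi$ and $\eta$ are sharp, $\eta$ is real and $\mathcal R(\eta)\subseteq\mathcal R(\xi)$, then there is a measurable map $f:X\to Y$ such that $\eta(E)=\xi(f^{-1}(E))$ for all $E\in\mathcal B$, and $\eta$ is a smearing of $\xi$ by the $\{0,1\}$-valued Markov kernel $\nu(x,E)=\chi_{f^{-1}(E)}(x)$. -/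

import Mathlib

open MeasureTheory ProbabilityTheory

/-- An effect algebra: a set with elements `0`, `1` and a partial binary operation `oplus`;
`oplus a b = some c` means that `a ⊕ b` exists and equals `c`, and `oplus a b = none` means that
`a ⊕ b` does not exist. -/
class EffectAlgebra (L : Type*) extends Zero L, One L where
  /-- the partial operation `⊕` -/
  oplus : L → L → Option L
  oplus_comm : ∀ a b c : L, oplus a b = some c → oplus b a = some c
  oplus_assoc : ∀ a b c d e : L, oplus b c = some d → oplus a d = some e →
    ∃ f : L, oplus a b = some f ∧ oplus f c = some e
  exists_unique_supplement : ∀ a : L, ∃! b : L, oplus a b = some 1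
  zero_one_law : ∀ a c : L, oplus 1 a = some c → a = 0

namespace EffectAlgebra

variable {L : Type*} [EffectAlgebra L]

/-- `a ≤ b` iff `a ⊕ c = b` for some `c`. -/
instance instLE : LE L := ⟨fun a b => ∃ c : L, oplus a c = some b⟩

/-- The orthosupplement `a'` of `a`: the unique element with `a ⊕ a' = 1`. -/
noncomputable def orthosupplement (a : L) : L := (exists_unique_supplement a).choose

/-- `a` is sharp: `0` is the only common lower bound of `a` and `a'`. -/
def IsSharpElement (a : L) : Prop := ∀ b : L, b ≤ a → b ≤ orthosupplement a → b = 0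

/-- The finite sum `(⋯((0 ⊕ a₁) ⊕ a₂) ⊕ ⋯) ⊕ aₙ`, which is `none` if one of its steps does not
exist. -/
def listSum (l : List L) : Option L :=
  l.foldl (fun s a => s.bind fun t => oplus t a) (some 0)

/-- A system `(a i)` is orthogonal if `⨁_{i ∈ J} a i` exists for each finite set `J` of indices;
a finite set of indices is presented by listing its elements, in any order. -/
def IsOrthogonal {ι : Type*} (a : ι → L) : Prop :=
  ∀ J : List ι, J.Nodup → ∃ s : L, listSum (J.map a) = some s

/-- `(a i)` is orthogonal and has the `⊕`-sum `b`, the join of the sums over the finite sets of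
indices. -/
def HasOplusSum {ι : Type*} (a : ι → L) (b : L) : Prop :=
  IsOrthogonal a ∧ IsLUB {s : L | ∃ J : List ι, J.Nodup ∧ listSum (J.map a) = some s} b

variable (L) in
/-- Each countable orthogonal system has a `⊕`-sum. -/
def IsSigmaOrthocomplete : Prop :=
  ∀ (ι : Type) [Countable ι] (a : ι → L), IsOrthogonal a → ∃ b : L, HasOplusSum a b

variable (L) in
/-- A `σ`-additive state. -/
structure SigmaState where
  toFun : L → ℝ
  mem_unitInterval : ∀ a : L, toFun a ∈ Set.Icc (0 : ℝ) 1
  map_one : toFun 1 = 1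
  map_oplus : ∀ a b c : L, oplus a b = some c → toFun c = toFun a + toFun b
  map_oplusSum : ∀ (ι : Type) [Countable ι] (a : ι → L) (b : L), HasOplusSum a b →
    HasSum (fun i => toFun (a i)) (toFun b)

instance : CoeFun (SigmaState L) (fun _ => L → ℝ) := ⟨SigmaState.toFun⟩

/-- The nonempty system `S` of states is order determining. -/
def IsOrderDetermining (S : Set (SigmaState L)) : Prop :=
  S.Nonempty ∧ ∀ a b : L, a ≤ b ↔ ∀ s ∈ S, s a ≤ s b

/-- An observable on `L` with value space the measurable space `X`. Only its values on the
measurable sets are meaningful. -/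
structure Observable (X : Type*) [MeasurableSpace X] (L : Type*) [EffectAlgebra L] where
  toFun : Set X → L
  map_univ : toFun Set.univ = 1
  map_iUnion : ∀ E : ℕ → Set X, (∀ i, MeasurableSet (E i)) →
    (∀ i j, i ≠ j → E i ∩ E j = ∅) → HasOplusSum (fun i => toFun (E i)) (toFun (⋃ i, E i))

namespace Observable

variable {X : Type*} [MeasurableSpace X] {Y : Type*} [MeasurableSpace Y]

instance : CoeFun (Observable X L) (fun _ => Set X → L) := ⟨Observable.toFun⟩

/-- The range `{ξ(A) : A measurable}`. -/
def range (ξ : Observable X L) : Set L := {a : L | ∃ A : Set X, MeasurableSet A ∧ ξ A = a}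

/-- An observable is sharp if its range consists of sharp elements. -/
def IsSharp (ξ : Observable X L) : Prop := ∀ a ∈ ξ.range, IsSharpElement a

/-- An observable is real if its value space is a Borel subset of `ℝ` with its Borel sets
(in particular if it is `ℝ`), up to identification by a measurable embedding into `ℝ`. -/
def IsReal (_η : Observable Y L) : Prop := ∃ e : Y → ℝ, MeasurableEmbedding e

theorem hasSum_state (ξ : Observable X L) (m : SigmaState L) (E : ℕ → Set X)
    (hE : ∀ i, MeasurableSet (E i)) (hd : ∀ i j, i ≠ j → E i ∩ E j = ∅) :
    HasSum (fun i => m (ξ (E i))) (m (ξ (⋃ i, E i))) :=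
  m.map_oplusSum ℕ _ _ (ξ.map_iUnion E hE hd)

theorem state_empty (ξ : Observable X L) (m : SigmaState L) : m (ξ ∅) = 0 := by
  have h := ξ.hasSum_state m (fun _ => ∅) (fun _ => MeasurableSet.empty) (by simp)
  exact (summable_const_iff (β := ℕ) _).1 h.summable

/-- The probability measure `m ∘ ξ`, the distribution of `ξ` in the state `m`. -/
noncomputable def law (ξ : Observable X L) (m : SigmaState L) : Measure X :=
  Measure.ofMeasurable (fun A _ => ENNReal.ofReal (m (ξ A)))
    (by simp [state_empty])
    (fun E hE hd => by
      have h := ξ.hasSum_state m E hE fun i j hij => Set.disjoint_iff_inter_eq_empty.1 (hd hij)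
      rw [← h.tsum_eq]
      exact ENNReal.ofReal_tsum_of_nonneg (fun i => (m.mem_unitInterval _).1) h.summable)

theorem law_apply (ξ : Observable X L) (m : SigmaState L) {A : Set X} (hA : MeasurableSet A) :
    ξ.law m A = ENNReal.ofReal (m (ξ A)) :=
  Measure.ofMeasurable_apply A hA

end Observable

/-- `ν` is a weak Markov kernel with respect to the set `P` of probability measures. Only the
values `ν x B` at measurable `B` are meaningful. -/
structure IsWeakMarkovKernel {X Y : Type*} [MeasurableSpace X] [MeasurableSpace Y]
    (P : Set (Measure X)) (ν : X → Set Y → ℝ) : Prop where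
  measurable : ∀ B : Set Y, MeasurableSet B → Measurable fun x => ν x B
  mem_unitInterval : ∀ B : Set Y, MeasurableSet B → ∀ p ∈ P, ∀ᵐ x ∂p, 0 ≤ ν x B ∧ ν x B ≤ 1
  univ_eq_one : ∀ p ∈ P, ∀ᵐ x ∂p, ν x Set.univ = 1
  empty_eq_zero : ∀ p ∈ P, ∀ᵐ x ∂p, ν x ∅ = 0
  hasSum : ∀ B : ℕ → Set Y, (∀ n, MeasurableSet (B n)) → (∀ n k, n ≠ k → B n ∩ B k = ∅) →
    ∀ p ∈ P, ∀ᵐ x ∂p, HasSum (fun n => ν x (B n)) (ν x (⋃ n, B n))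

/-- `η` is a smearing of `ξ` by `ν`: `ν` is a weak Markov kernel with respect to the measures
`m ∘ ξ`, `m ∈ S`, and `m (η G) = ∫ ν(x, G) d(m ∘ ξ)(x)` for all measurable `G` and all `m ∈ S`. -/
def IsSmearingBy {X Y : Type*} [MeasurableSpace X] [MeasurableSpace Y] (S : Set (SigmaState L))
    (ξ : Observable X L) (η : Observable Y L) (ν : X → Set Y → ℝ) : Prop :=
  IsWeakMarkovKernel {p : Measure X | ∃ m ∈ S, p = ξ.law m} ν ∧
    ∀ G : Set Y, MeasurableSet G → ∀ m ∈ S, m (η G) = ∫ x, ν x G ∂(ξ.law m)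

/-- The function `(x, G) ↦ κ(x, G)` of a Markov kernel satisfies the conditions on weak Markov
kernels everywhere. -/
theorem isWeakMarkovKernel_of_kernel {X Y : Type*} [MeasurableSpace X] [MeasurableSpace Y]
    (P : Set (Measure X)) (κ : Kernel X Y) [IsMarkovKernel κ] :
    IsWeakMarkovKernel P (fun x G => (κ x).real G) where
  measurable B hB := (κ.measurable_coe hB).ennreal_toReal
  mem_unitInterval B _ p _ := Filter.Eventually.of_forall fun _ =>
    ⟨measureReal_nonneg, measureReal_le_one⟩
  univ_eq_one p _ := Filter.Eventually.of_forall fun _ => by simp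
  empty_eq_zero p _ := Filter.Eventually.of_forall fun _ => by simp
  hasSum B hB hd p _ := Filter.Eventually.of_forall fun x => by
    have h := measure_iUnion (μ := κ x)
      (fun i j hij => Set.disjoint_iff_inter_eq_empty.2 (hd i j hij)) hB
    have h1 : ∑' n, κ x (B n) ≠ ⊤ := by rw [← h]; exact measure_ne_top _ _
    simp only [measureReal_def]
    rw [h, ENNReal.tsum_toReal_eq (ENNReal.ne_top_of_tsum_ne_top h1)]
    exact (ENNReal.summable_toReal h1).hasSum

end EffectAlgebra

open EffectAlgebra

namespace EffectAlgebra

/-! ### Cancellation and antisymmetry in effect algebras. -/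

section

variable {L : Type*} [EffectAlgebra L]

/-! States in `S` separate the elements of `L`, so both parts reduce to comparing probabilities in
each state. For part 1, a kernel value `ν(·, E)` in `{0, 1}` agrees almost everywhere with the
indicator of `{ν(·, E) = 1}`, and `ξ` of that set must be `η E`. For part 2, regard `Y` as lying in
`ℝ` via `e` and choose `A r` with `ξ (A r) = η {e < r}` for rational `r`. Sharpness of `ξ` makes the
`A r` increasing up to sets null in every state (`IsSharp.law_diff_eq_zero`). Hence `x ↦ inf {r | x
∈ A r}` has the distribution of `e` in every state (`map_levelFunction`), and a measurable left
inverse of `e` turns it into `f`. -/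

theorem oplus_one_zero : oplus (1 : L) 0 = some 1 := by
  obtain ⟨b, hb, -⟩ := exists_unique_supplement (1 : L)
  obtain rfl := zero_one_law b 1 hb
  exact hb

theorem oplus_orthosupplement (a : L) : oplus a (orthosupplement a) = some 1 :=
  (exists_unique_supplement a).choose_spec.1

theorem oplus_zero (a : L) : oplus a 0 = some a := by
  obtain ⟨b, hb, -⟩ := exists_unique_supplement a
  have h0 : oplus (0 : L) 1 = some 1 := oplus_comm _ _ _ oplus_one_zero
  obtain ⟨f, hf, hfb⟩ := oplus_assoc 0 a b 1 1 hb h0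
  have : f = a := (exists_unique_supplement b).unique (oplus_comm _ _ _ hfb) (oplus_comm _ _ _ hb)
  subst this
  exact oplus_comm _ _ _ hf

/-- Adding the supplement `d'` and reassociating makes both `b` and `c` the supplement of `d' ⊕ a`.
-/
theorem oplus_left_cancel {a b c d : L} (hb : oplus a b = some d) (hc : oplus a c = some d) :
    b = c := by
  have hd := oplus_comm _ _ _ (oplus_orthosupplement d)
  obtain ⟨f, hf, hfb⟩ := oplus_assoc _ _ _ _ _ hb hd
  obtain ⟨g, hg, hgc⟩ := oplus_assoc _ _ _ _ _ hc hd
  obtain rfl : f = g := Option.some.inj (hf.symm.trans hg)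
  exact (exists_unique_supplement f).unique hfb hgc

theorem eq_zero_of_oplus_eq_zero {a b : L} (h : oplus a b = some 0) : a = 0 := by
  obtain ⟨f, hf, -⟩ := oplus_assoc _ _ _ _ _ h (oplus_one_zero (L := L))
  exact zero_one_law _ _ hf

theorem eq_of_le_of_le {a b : L} (hab : a ≤ b) (hba : b ≤ a) : a = b := by
  obtain ⟨c, hc⟩ := hab
  obtain ⟨d, hd⟩ := hba
  obtain ⟨f, hf, hfa⟩ := oplus_assoc d c a b a (oplus_comm _ _ _ hc) (oplus_comm _ _ _ hd)
  obtain rfl : f = 0 := oplus_left_cancel (oplus_comm _ _ _ hfa) (oplus_zero a)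
  obtain rfl := eq_zero_of_oplus_eq_zero hf
  exact Option.some.inj (hd.symm.trans (oplus_zero b))

/-! ### States, sharpness and the first part. -/

namespace SigmaState

theorem map_zero (m : SigmaState L) : m (0 : L) = 0 := by
  have := m.map_oplus _ _ _ (oplus_zero (0 : L))
  linarith

theorem map_orthosupplement (m : SigmaState L) (a : L) : m (orthosupplement a) = 1 - m a := by
  have := m.map_oplus _ _ _ (oplus_orthosupplement a)
  have := m.map_one
  linarith

end SigmaState

theorem IsOrderDetermining.eq {S : Set (SigmaState L)} (hS : IsOrderDetermining S) {a b : L}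
    (h : ∀ m ∈ S, m a = m b) : a = b :=
  eq_of_le_of_le ((hS.2 _ _).2 fun m hm => (h m hm).le) ((hS.2 _ _).2 fun m hm => (h m hm).ge)

namespace Observable

variable {X : Type*} [MeasurableSpace X] {Y : Type*} [MeasurableSpace Y]

instance isProbabilityMeasure_law (ξ : Observable X L) (m : SigmaState L) :
    IsProbabilityMeasure (ξ.law m) :=
  ⟨by rw [ξ.law_apply m MeasurableSet.univ, ξ.map_univ, m.map_one, ENNReal.ofReal_one]⟩

theorem law_real_apply (ξ : Observable X L) (m : SigmaState L) {A : Set X}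
    (hA : MeasurableSet A) : (ξ.law m).real A = m (ξ A) := by
  rw [measureReal_def, ξ.law_apply m hA, ENNReal.toReal_ofReal (m.mem_unitInterval _).1]

/-- In the range of a sharp observable, the order of the effects is the inclusion of the sets up
to sets that are null in every state. -/
theorem IsSharp.law_diff_eq_zero {S : Set (SigmaState L)} (hS : IsOrderDetermining S)
    {ξ : Observable X L} (hξ : ξ.IsSharp) {A B : Set X} (hA : MeasurableSet A)
    (hB : MeasurableSet B) (h : ∀ m ∈ S, m (ξ A) ≤ m (ξ B)) (m : SigmaState L) :
    ξ.law m (A \ B) = 0 := by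
  have h0 : ξ (A \ B) = 0 := by
    -- `ξ (A \ B)` is below `ξ A`, hence below `ξ B`, and it is below `(ξ B)'` because `A \ B`
    -- misses `B`; sharpness of `ξ B` makes it `0`.
    refine hξ (ξ B) ⟨B, hB, rfl⟩ _ ((hS.2 _ _).2 fun s hs => ?_) ((hS.2 _ _).2 fun s _ => ?_)
    · refine le_trans ?_ (h s hs)
      rw [← ξ.law_real_apply s (hA.diff hB), ← ξ.law_real_apply s hA]
      exact measureReal_mono Set.sdiff_subset
    · rw [s.map_orthosupplement, ← ξ.law_real_apply s (hA.diff hB), ← ξ.law_real_apply s hB,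
        ← probReal_compl_eq_one_sub hB]
      exact measureReal_mono fun x hx => hx.2
  rw [ξ.law_apply m (hA.diff hB), h0, m.map_zero, ENNReal.ofReal_zero]

theorem range_subset_of_isSmearingBy {S : Set (SigmaState L)} (hS : IsOrderDetermining S)
    {ξ : Observable X L} {η : Observable Y L} {ν : X → Set Y → ℝ} (hν : IsSmearingBy S ξ η ν)
    (h01 : ∀ E : Set Y, MeasurableSet E → ∀ m ∈ S, ∀ᵐ x ∂(ξ.law m), ν x E = 0 ∨ ν x E = 1) :
    η.range ⊆ ξ.range := by
  rintro _ ⟨E, hE, rfl⟩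
  have hA : MeasurableSet {x | ν x E = 1} := hν.1.measurable E hE (measurableSet_singleton 1)
  refine ⟨{x | ν x E = 1}, hA, hS.eq fun m hm => ?_⟩
  have hae : (fun x => ν x E) =ᵐ[ξ.law m] {x | ν x E = 1}.indicator 1 := by
    filter_upwards [h01 E hE m hm] with x hx
    rcases hx with hx | hx <;> simp [Set.indicator, hx]
  rw [hν.2 E hE m hm, integral_congr_ae hae, integral_indicator_one hA, ξ.law_real_apply m hA]

end Observable

/-! ### Functions with level sets prescribed up to null sets. -/

/-- A variant of `measure_biUnion_eq_iSup` for a family that is increasing up to null sets. -/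
theorem measure_biUnion_eq_iSup_of_diff_null {X : Type*} [MeasurableSpace X] {p : Measure X} {A : ℚ → Set X}
    (hA : ∀ r s, r ≤ s → p (A r \ A s) = 0) {T : Set ℚ} (hT : IsLowerSet T) :
    p (⋃ r ∈ T, A r) = ⨆ r ∈ T, p (A r) := by
  -- Enlarging `A r` to the union of all `A s`, `s ≤ r`, adds only countably many null sets, gives a
  -- truly monotone family, and leaves the union over the lower set `T` unchanged.
  have hsub (r : ℚ) : A r ⊆ Set.accumulate A r := Set.subset_accumulate
  have heq (r : ℚ) : p (Set.accumulate A r) = p (A r) := by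
    refine le_antisymm ?_ (measure_mono (hsub r))
    have h0 : p (Set.accumulate A r \ A r) = 0 := by
      rw [Set.accumulate_def]
      simp only [Set.iUnion_sdiff]
      exact (measure_biUnion_null_iff (Set.to_countable (Set.Iic r))).2 fun s hs => hA s r hs
    exact (measure_le_inter_add_sdiff p _ (A r)).trans
      (by rw [h0, add_zero]; exact measure_mono Set.inter_subset_right)
  have hU : ⋃ r ∈ T, A r = ⋃ r ∈ T, Set.accumulate A r := by
    refine Set.Subset.antisymm (Set.iUnion₂_mono fun r _ => hsub r) (Set.iUnion₂_subset ?_)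
    exact fun r hr => Set.iUnion₂_subset fun s hs => Set.subset_biUnion_of_mem (u := A) (hT hs hr)
  rw [hU, measure_biUnion_eq_iSup (Set.to_countable T)]
  · simp only [heq]
  · intro r hr s hs
    rcases le_total r s with h | h
    · exact ⟨s, hs, Set.monotone_accumulate h, subset_rfl⟩
    · exact ⟨r, hr, subset_rfl, Set.monotone_accumulate h⟩

open Classical in
/-- The function whose strict sublevel sets are the unions of the sets `A r`. -/
noncomputable def levelFunction {X : Type*} (A : ℚ → Set X) (x : X) : EReal :=
  -- The infimum is `⊤` where `x` lies in no `A r` and `⊥` where the admissible `r` are unbounded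
  -- below, hence the values in `EReal`.
  ⨅ r : ℚ, if x ∈ A r then ((r : ℝ) : EReal) else ⊤

theorem levelFunction_lt_iff {X : Type*} {A : ℚ → Set X} {x : X} {c : EReal} :
    levelFunction A x < c ↔ ∃ r : ℚ, ((r : ℝ) : EReal) < c ∧ x ∈ A r := by
  rw [levelFunction, iInf_lt_iff]
  refine exists_congr fun r => ?_
  split_ifs with h <;> simp [h]

theorem measurable_levelFunction {X : Type*} [MeasurableSpace X] {A : ℚ → Set X}
    (hA : ∀ r, MeasurableSet (A r)) : Measurable (levelFunction A) := by
  classical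
  exact Measurable.iInf fun r => Measurable.ite (hA r) measurable_const measurable_const

/-- If the sets `A r` have the probabilities of the events `e < r` and are increasing up to null
sets, then the function with the level sets `A r` has the distribution of `e`. -/
theorem map_levelFunction {X Y : Type*} [MeasurableSpace X] [MeasurableSpace Y]
    {p : Measure X} {q : Measure Y} [IsProbabilityMeasure p] [IsProbabilityMeasure q]
    {A : ℚ → Set X} (hA : ∀ r, MeasurableSet (A r)) {e : Y → ℝ} (he : Measurable e)
    (hpq : ∀ r : ℚ, p (A r) = q {y | e y < r}) (hnull : ∀ r s, r ≤ s → p (A r \ A s) = 0) :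
    p.map (levelFunction A) = q.map fun y => (e y : EReal) := by
  have hF := measurable_levelFunction hA
  have hE : Measurable fun y => (e y : EReal) := measurable_coe_real_ereal.comp he
  have := Measure.isProbabilityMeasure_map (μ := p) hF.aemeasurable
  have := Measure.isProbabilityMeasure_map (μ := q) hE.aemeasurable
  refine Measure.ext_of_Ici _ _ fun c => ?_
  -- Both events `< c` are unions over rational `r < c`, so their probabilities are suprema of the
  -- same numbers.
  have hIio : p.map (levelFunction A) (Set.Iio c) = q.map (fun y => (e y : EReal)) (Set.Iio c) := by
    let T : Set ℚ := {r | ((r : ℝ) : EReal) < c}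
    have hT : IsLowerSet T := fun r s hsr hr =>
      lt_of_le_of_lt (EReal.coe_le_coe_iff.2 (Rat.cast_le.2 hsr)) hr
    have h1 : levelFunction A ⁻¹' Set.Iio c = ⋃ r ∈ T, A r := by
      ext x
      simp [levelFunction_lt_iff, T]
    have h2 : (fun y => (e y : EReal)) ⁻¹' Set.Iio c = ⋃ r ∈ T, {y | e y < (r : ℝ)} := by
      ext y
      simp only [Set.mem_preimage, Set.mem_Iio, Set.mem_iUnion, exists_prop, Set.mem_ofPred_eq, T]
      rw [EReal.lt_iff_exists_rat_btwn]
      simp only [EReal.coe_lt_coe_iff, and_comm]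
    rw [Measure.map_apply hF measurableSet_Iio, Measure.map_apply hE measurableSet_Iio, h1, h2,
      measure_biUnion_eq_iSup_of_diff_null hnull hT,
      measure_biUnion_eq_iSup_of_diff_null ?_ hT]
    · simp only [hpq]
    · intro r s hrs
      rw [Set.sdiff_eq_empty.2, measure_empty]
      exact fun y (hy : e y < r) => hy.trans_le (Rat.cast_le.2 hrs)
  rw [← Set.compl_Iio, prob_compl_eq_one_sub measurableSet_Iio,
    prob_compl_eq_one_sub measurableSet_Iio, hIio]

/-! ### Construction of `f` and of its kernel. -/

namespace Observable

variable {X : Type*} [MeasurableSpace X] {Y : Type*} [MeasurableSpace Y]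

theorem nonempty_of_sigmaState (η : Observable Y L) (m : SigmaState L) : Nonempty Y := by
  by_contra h
  rw [not_nonempty_iff] at h
  have h0 := η.state_empty m
  rw [← Set.univ_eq_empty_iff.2 h, η.map_univ, m.map_one] at h0
  exact one_ne_zero h0

theorem exists_measurable_eq_preimage {S : Set (SigmaState L)} (hS : IsOrderDetermining S)
    {ξ : Observable X L} {η : Observable Y L} (hξ : ξ.IsSharp) (hη : η.IsReal)
    (h : η.range ⊆ ξ.range) :
    ∃ f : X → Y, Measurable f ∧ ∀ E : Set Y, MeasurableSet E → η E = ξ (f ⁻¹' E) := by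
  obtain ⟨m₀, -⟩ := hS.1
  have hY := η.nonempty_of_sigmaState m₀
  obtain ⟨e, he⟩ := hη
  have hlt (r : ℚ) : MeasurableSet {y | e y < r} := he.measurable measurableSet_Iio
  choose A hA hAη using fun r : ℚ => h ⟨{y | e y < r}, hlt r, rfl⟩
  have hE : MeasurableEmbedding fun y => (e y : EReal) :=
    EReal.isOpenEmbedding_coe.measurableEmbedding.comp he
  -- `g` is a measurable left inverse of `e`, arbitrary off its range; this needs a point of `Y`,
  -- which exists because a state gives `η ∅` the value `0` and `η Y` the value `1`.
  obtain ⟨g, hg, hge⟩ := hE.exists_measurable_extend measurable_id fun _ => hY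
  have hF := measurable_levelFunction hA
  -- The map is fixed before the state `m` enters, so equality of laws in each state suffices.
  refine ⟨g ∘ levelFunction A, hg.comp hF, fun B hB => hS.eq fun m _ => ?_⟩
  have hnull (r s : ℚ) (hrs : r ≤ s) : ξ.law m (A r \ A s) = 0 := by
    refine hξ.law_diff_eq_zero hS (hA r) (hA s) (fun t _ => ?_) m
    rw [hAη, hAη, ← η.law_real_apply t (hlt r), ← η.law_real_apply t (hlt s)]
    exact measureReal_mono fun y (hy : e y < r) => hy.trans_le (Rat.cast_le.2 hrs)
  have hlaw : (ξ.law m).map (levelFunction A) = (η.law m).map fun y => (e y : EReal) :=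
    map_levelFunction hA he.measurable
      (fun r => by rw [ξ.law_apply m (hA r), η.law_apply m (hlt r), hAη]) hnull
  have hmap : (ξ.law m).map (g ∘ levelFunction A) = η.law m := by
    rw [← Measure.map_map hg hF, hlaw, Measure.map_map hg hE.measurable, hge, Measure.map_id]
  rw [← η.law_real_apply m hB, ← hmap, map_measureReal_apply (hg.comp hF) hB,
    ξ.law_real_apply m (hg.comp hF hB)]

theorem deterministic_real_apply {f : X → Y} (hf : Measurable f) (x : X) {E : Set Y}
    (hE : MeasurableSet E) :
    (Kernel.deterministic f hf x).real E = (f ⁻¹' E).indicator (fun _ => (1 : ℝ)) x := by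
  rw [measureReal_def, Kernel.deterministic_apply' hf x hE]
  by_cases hx : f x ∈ E <;> simp [Set.indicator, hx]

theorem isSmearingBy_deterministic (S : Set (SigmaState L)) {ξ : Observable X L}
    {η : Observable Y L} {f : X → Y} (hf : Measurable f)
    (h : ∀ E : Set Y, MeasurableSet E → η E = ξ (f ⁻¹' E)) :
    IsSmearingBy S ξ η fun x E => (Kernel.deterministic f hf x).real E := by
  refine ⟨isWeakMarkovKernel_of_kernel _ _, fun G hG m _ => ?_⟩
  simp only [deterministic_real_apply hf _ hG]
  rw [h G hG, ← ξ.law_real_apply m (hf hG)]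
  exact (integral_indicator_one (hf hG)).symm

end Observable

end

end EffectAlgebra

theorem theorem4p3 {L : Type*} [EffectAlgebra L] (hL : IsSigmaOrthocomplete L)
    (S : Set (SigmaState L)) (hS : IsOrderDetermining S)
    {X Y : Type*} [MeasurableSpace X] [MeasurableSpace Y]
    (ξ : Observable X L) (η : Observable Y L) :
    (∀ ν : X → Set Y → ℝ, IsSmearingBy S ξ η ν →
      (∀ E : Set Y, MeasurableSet E → ∀ m ∈ S, ∀ᵐ x ∂(ξ.law m), ν x E = 0 ∨ ν x E = 1) →
      η.range ⊆ ξ.range) ∧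
    (ξ.IsSharp → η.IsSharp → η.IsReal → η.range ⊆ ξ.range →
      ∃ f : X → Y, Measurable f ∧
        (∀ E : Set Y, MeasurableSet E → η E = ξ (f ⁻¹' E)) ∧
        ∃ κ : Kernel X Y, IsMarkovKernel κ ∧
          (∀ (x : X) (E : Set Y), MeasurableSet E →
            (κ x).real E = (f ⁻¹' E).indicator (fun _ => (1 : ℝ)) x) ∧
          IsSmearingBy S ξ η (fun x E => (κ x).real E)) := by
  refine ⟨fun ν hν h01 => Observable.range_subset_of_isSmearingBy hS hν h01,
    fun hξ _ hη h => ?_⟩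
  obtain ⟨f, hf, hfE⟩ := Observable.exists_measurable_eq_preimage hS hξ hη h
  exact ⟨f, hf, hfE, Kernel.deterministic f hf, inferInstance,
    fun x _ hE => Observable.deterministic_real_apply hf x hE,
    Observable.isSmearingBy_deterministic S hf hfE⟩
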